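/- Let $q$ be a prime power, let $k>1$ be an integer, put $\Delta=\frac{q^k-1}{q-1}$, and let $\gamma$ be a primitive element of $\mathbb F_{q^k}$ (a generator of $\mathbb F_{q^k}^*$). For an integer $a$ let $h_a(x)\in\mathbb F_q[x]$ be the minimal polynomial of $\gamma^{-a}$ over $\mathbb F_q$. A cyclic code of length $n$ over $\mathbb F_q$ has parity-check polynomial $h(x)$, a monic divisor of $x^n-1$, if it consists of the words $(c_0,\dots,c_{n-1})\in\mathbb F_q^n$ for which $\sum_i c_ix^i$ is divisible by $(x^n-1)/h(x)$; it is irreducible if it is a minimal nonzero cyclic code. An $[n,m,d]$ code is a linear code of length $n$, dimension $m$ and minimum Hamming distance $d$; it is called (Griesmer-)optimal if it attains the Griesmer bound, i.e. $n=\sum_{i=0}^{m-1}\lceil d/q^i\rceil$. Let $e_1,e_2$ be integers with $\gcd(q-1,ke_1-e_2)=1$ and $\gcd(\Delta,e_2)=1$. Then: (A) $\deg h_{\Delta e_1}=1$ and $\deg h_{e_2}=k$. Moreover $h_{\Delta e_1}$ and $h_{e_2}$ are the parity-check polynomials of two different irreducible cyclic codes of length $q^k-1$ over $\mathbb F_q$,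 each with exactly one nonzero weight, namely $q^k-1$ and $q^{k-1}(q-1)$ respectively. (B) The product $h_{\Delta e_1}h_{e_2}$ is the parity-check polynomial of a cyclic code $\mathcal C_{(\Delta e_1,e_2)}$ of length $q^k-1$ over $\mathbb F_q$. This code is an optimal $[q^k-1,\,k+1,\,q^{k-1}(q-1)-1]$ code with exactly three nonzero weights. It has $1$ word of weight $0$, $(q-1)(q^k-1)$ words of weight $q^{k-1}(q-1)-1$, $q^k-1$ words of weight $q^{k-1}(q-1)$, $q-1$ words of weight $q^k-1$, and no words of any other weight. If $B_j$ denotes the number of words of weight $j$ in the dual code of $\mathcal C_{(\Delta e_1,e_2)}$, then $B_1=B_2=0$ and $$B_3=\frac{(q^k-3)(q^k-1)(q-2)(q-1)}{6}.$$ Consequently, if $q>2$, this dual is a single-error-correcting code (it corrects one error, but not two) with parameters $[q^k-1,\,q^k-2-k,\,3]$. -/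

import Mathlib

open Polynomial

noncomputable section

namespace CyclicCodes

variable {F : Type*} [Field F] {n : ℕ}

/-- The polynomial `c₀ + c₁ X + ⋯ + c_{n-1} X^{n-1}` attached to a word of length `n`. -/
def wordPoly (c : Fin n → F) : F[X] := ∑ i : Fin n, C (c i) * X ^ (i : ℕ)

/-- A linear code is cyclic if it is stable under `(c₀, …, c_{n-1}) ↦ (c₁, …, c_{n-1}, c₀)`. -/
def IsCyclicCode (D : Submodule F (Fin n → F)) : Prop :=
  ∀ c ∈ D, c ∘ finRotate n ∈ D

/-- `h` is the parity-check polynomial of the code `D` of length `n`: it is monic, it divides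
`X ^ n - 1`, and `D` consists of the words divisible by the generator polynomial
`g = (X ^ n - 1) / h`. -/
def IsParityCheckPolynomial (h : F[X]) (D : Submodule F (Fin n → F)) : Prop :=
  h.Monic ∧ ∃ g : F[X], g * h = X ^ n - 1 ∧ ∀ c : Fin n → F, c ∈ D ↔ g ∣ wordPoly c

/-- The words `c` of length `n` with `h(x) c(x) = 0` in `F[x] / (x ^ n - 1)`. When `h` is a monic
divisor of `X ^ n - 1`, this is the cyclic code with parity-check polynomial `h`. -/
def cyclicCode (n : ℕ) (h : F[X]) : Submodule F (Fin n → F) where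
  carrier := {c | (X ^ n - 1 : F[X]) ∣ h * wordPoly c}
  zero_mem' := by simp [wordPoly]
  add_mem' := by
    intro a b ha hb
    have : wordPoly (a + b) = wordPoly a + wordPoly b := by
      simp [wordPoly, add_mul, Finset.sum_add_distrib]
    simp only [Set.mem_ofPred_eq, this, mul_add] at *
    exact dvd_add ha hb
  smul_mem' := by
    intro r a ha
    have : wordPoly (r • a) = C r * wordPoly a := by
      simp [wordPoly, Finset.mul_sum, mul_assoc]
    simp only [Set.mem_ofPred_eq, this] at *
    rw [mul_left_comm]
    exact Dvd.dvd.mul_left ha _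

/-- An irreducible cyclic code: a minimal nonzero cyclic code. -/
def IsIrreducibleCyclicCode (D : Submodule F (Fin n → F)) : Prop :=
  IsCyclicCode D ∧ D ≠ ⊥ ∧
    ∀ E : Submodule F (Fin n → F), IsCyclicCode E → E ≤ D → E = ⊥ ∨ E = D

/-- The dual code with respect to the standard bilinear form. -/
def dualCode (D : Submodule F (Fin n → F)) : Submodule F (Fin n → F) where
  carrier := {x | ∀ c ∈ D, c ⬝ᵥ x = 0}
  zero_mem' := by simp
  add_mem' := by
    intro a b ha hb c hc
    rw [dotProduct_add, ha c hc, hb c hc, add_zero]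
  smul_mem' := by
    intro r a ha c hc
    rw [dotProduct_smul, ha c hc, smul_zero]

variable [DecidableEq F]

/-- The number of codewords of Hamming weight `w`. -/
def weightCount (D : Submodule F (Fin n → F)) (w : ℕ) : ℕ :=
  {c : Fin n → F | c ∈ D ∧ hammingNorm c = w}.ncard

/-- The set of Hamming weights of the nonzero codewords. -/
def nonzeroWeights (D : Submodule F (Fin n → F)) : Set ℕ :=
  {w | ∃ c ∈ D, c ≠ 0 ∧ hammingNorm c = w}

/-- `D` is an `[n, m, d]` linear code: dimension `m` and minimum Hamming distance `d`. -/
def HasParameters (D : Submodule F (Fin n → F)) (m d : ℕ) : Prop :=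
  Module.finrank F D = m ∧
    IsLeast {w | ∃ x ∈ D, ∃ y ∈ D, x ≠ y ∧ hammingDist x y = w} d

/-- Optimality with respect to the Griesmer bound: the length of the `[n, m, d]` code `D` equals
`∑_{i < m} ⌈d / q ^ i⌉`, where `q` is the size of the alphabet. -/
def IsGriesmerOptimal (D : Submodule F (Fin n → F)) : Prop :=
  ∃ m d : ℕ, HasParameters D m d ∧
    n = ∑ i ∈ Finset.range m, ⌈(d : ℚ) / (Nat.card F : ℚ) ^ i⌉₊

/-- Every received word is within Hamming distance `t` of at most one codeword. -/
def CorrectsErrors (D : Submodule F (Fin n → F)) (t : ℕ) : Prop :=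
  ∀ y : Fin n → F, ∀ c ∈ D, ∀ c' ∈ D, hammingDist y c ≤ t → hammingDist y c' ≤ t → c = c'

/-- `Δ = (q ^ k - 1) / (q - 1)`. -/
def Delta (q k : ℕ) : ℕ := (q ^ k - 1) / (q - 1)

/-- `h_a`, the minimal polynomial over `F` of `γ ^ (-a)`. -/
def hPoly (F : Type*) [Field F] {K : Type*} [Field K] [Algebra F K] (γ : Kˣ) (a : ℤ) : F[X] :=
  minpoly F ((γ ^ (-a) : Kˣ) : K)

end CyclicCodes

end

/-! Put N = q^k - 1 and β = γ^e₂. The norm from K to F is the Δ-th power, so δ = γ^(Δ e₁) is the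
norm of γ^e₁ and lies in F. The words a δ^i + Tr(b β^i), with (a, b) in F × K, lie in the cyclic
code whose parity-check polynomial is (X - δ⁻¹) times the minimal polynomial of β⁻¹. Factoring out
δ^i turns them into δ^i (a + Tr(b (β/δ)^i)). Since N = Δ (q - 1) and Δ ≡ k mod q - 1, the two gcd
conditions say exactly that e₂ - Δ e₁ is prime to N (`isCoprime_pow_sub_one`). Hence β/δ is again a
generator, and its powers run once through K*. Up to nonzero column multipliers, the words are the
affine functions x ↦ a + Tr(bx) evaluated on K*.

Weights thus come from counting points of affine hyperplanes (`hammingNorm_affineTraceWord`). Dual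
words are, after rescaling, affine relations between points of K* (`mem_dualCode_range_iff`). Two
distinct points are affinely independent, so weights 1 and 2 do not occur; weight 3 is a double
count (`six_mul_ncard_isAffineRelation`).

Dimensions are squeezed: the trace words bound each code from below, and the degree of its
parity-check polynomial bounds it from above (`finrank_cyclicCode_le`). This also yields that `f₂`
has degree k. -/

namespace CyclicCodes

/-! ### Cyclic codes: explicit words and the dimension bound -/

section CyclicCode

variable {F K : Type*} [Field F] [Field K] [Algebra F K] {n : ℕ}

/-- Applying a linear functional to the coefficients of a polynomial. -/
noncomputable def mapCoeff (l : K →ₗ[F] F) : K[X] →ₗ[F] F[X] :=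
  Polynomial.lsum fun m => (monomial m : F →ₗ[F] F[X]) ∘ₗ l

theorem mapCoeff_monomial (l : K →ₗ[F] F) (m : ℕ) (a : K) :
    mapCoeff l (monomial m a) = monomial m (l a) := by
  simp [mapCoeff]

/-- F[X]-linearity is what carries a divisibility by X^n - 1 from K[X] down to F[X]. -/
theorem mapCoeff_map_mul (l : K →ₗ[F] F) (p : F[X]) (w : K[X]) :
    mapCoeff l (p.map (algebraMap F K) * w) = p * mapCoeff l w := by
  induction w using Polynomial.induction_on' with
  | add v w hv hw => rw [mul_add, map_add, hv, hw, map_add, mul_add]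
  | monomial m a =>
    induction p using Polynomial.induction_on' with
    | add p r hp hr => rw [Polynomial.map_add, add_mul, map_add, hp, hr, add_mul]
    | monomial j b =>
      rw [Polynomial.map_monomial, monomial_mul_monomial, mapCoeff_monomial, mapCoeff_monomial,
        monomial_mul_monomial, ← Algebra.smul_def, map_smul, smul_eq_mul]

/-- The geometric word of ratio `ω`, read through a linear functional, lies in the cyclic code
whose parity-check polynomial vanishes at `ω⁻¹`. -/
theorem functional_pow_mem_cyclicCode (l : K →ₗ[F] F) {ω : K} (hω : ω ^ n = 1) (hω0 : ω ≠ 0)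
    {h : F[X]} (hh : aeval ω⁻¹ h = 0) :
    (fun i : Fin n => l (ω ^ (i : ℕ))) ∈ cyclicCode n h := by
  have hroot : X - C ω⁻¹ ∣ h.map (algebraMap F K) := by
    rw [dvd_iff_isRoot, IsRoot, eval_map_algebraMap, hh]
  obtain ⟨r, hr⟩ := hroot
  set w : K[X] := ∑ i ∈ Finset.range n, monomial i (ω ^ i) with hw
  -- `w` is the geometric sum of the powers of ωX, and ω^n = 1.
  have hgeom : (X - C ω⁻¹) * w = C ω⁻¹ * (X ^ n - 1) := by
    have h1 : w = ∑ i ∈ Finset.range n, (C ω * X) ^ i := by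
      refine Finset.sum_congr rfl fun i _ => ?_
      rw [mul_pow, ← C_pow, C_mul_X_pow_eq_monomial]
    have h2 : (X - C ω⁻¹ : K[X]) = C ω⁻¹ * (C ω * X - 1) := by
      rw [mul_sub, ← mul_assoc, ← C_mul, inv_mul_cancel₀ hω0]; simp
    rw [h1, h2, mul_assoc, mul_geom_sum, mul_pow, ← C_pow, hω]; simp
  have hword : wordPoly (fun i : Fin n => l (ω ^ (i : ℕ))) = mapCoeff l w := by
    rw [hw, map_sum, Finset.sum_range]
    exact Finset.sum_congr rfl fun i _ => by
      rw [mapCoeff_monomial, C_mul_X_pow_eq_monomial]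
  change X ^ n - 1 ∣ h * wordPoly _
  -- Over K, h = (X - ω⁻¹) r, so h w = r ω⁻¹ (X^n - 1); apply `l` to the coefficients.
  refine ⟨mapCoeff l (r * C ω⁻¹), ?_⟩
  rw [hword, ← mapCoeff_map_mul, ← mapCoeff_map_mul, hr]
  congr 1
  rw [mul_right_comm, hgeom]
  simp only [Polynomial.map_sub, Polynomial.map_pow, Polynomial.map_X, Polynomial.map_one]
  ring

theorem coeff_wordPoly (c : Fin n → F) (i : Fin n) : (wordPoly c).coeff i = c i := by
  simp [wordPoly, finsetSum_coeff, coeff_X_pow, ← Fin.ext_iff]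

theorem degree_wordPoly_lt (c : Fin n → F) : (wordPoly c).degree < n := by
  refine (degree_sum_le _ _).trans_lt ?_
  refine (Finset.sup_lt_iff (WithBot.bot_lt_coe n)).2 fun i _ =>
    (degree_C_mul_X_pow_le _ _).trans_lt (WithBot.coe_lt_coe.2 i.2)

/-- `wordPoly` as a linear map. -/
noncomputable def wordPolyHom (F : Type*) [Field F] (n : ℕ) : (Fin n → F) →ₗ[F] F[X] where
  toFun := wordPoly
  map_add' a b := by simp [wordPoly, add_mul, Finset.sum_add_distrib]
  map_smul' r a := by simp [wordPoly, Finset.smul_sum, smul_eq_C_mul, mul_assoc]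

theorem wordPolyHom_injective : Function.Injective (wordPolyHom F n) := fun a b h =>
  funext fun i => by
    rw [← coeff_wordPoly a, ← coeff_wordPoly b]
    exact congrArg (fun p => p.coeff i) h

theorem mem_cyclicCode_iff {g h : F[X]} (hn : n ≠ 0) (hgh : g * h = X ^ n - 1) (c : Fin n → F) :
    c ∈ cyclicCode n h ↔ g ∣ wordPoly c := by
  have hh : h ≠ 0 := by
    rintro rfl
    exact (X_pow_sub_C_ne_zero (Nat.pos_of_ne_zero hn) (1 : F)) (by simpa using hgh.symm)
  change X ^ n - 1 ∣ h * wordPoly c ↔ _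
  rw [← hgh, mul_comm g h, mul_dvd_mul_iff_left hh]

theorem cyclicCode_le_of_dvd {f h : F[X]} (hfh : f ∣ h) : cyclicCode n f ≤ cyclicCode n h :=
  fun _ hc => Dvd.dvd.trans hc (mul_dvd_mul_right hfh _)

theorem isParityCheckPolynomial_cyclicCode {h : F[X]} (hn : n ≠ 0) (hm : h.Monic)
    (hdvd : h ∣ X ^ n - 1) : IsParityCheckPolynomial h (cyclicCode n h) := by
  obtain ⟨g, hg⟩ := hdvd
  rw [mul_comm] at hg
  exact ⟨hm, g, hg.symm, mem_cyclicCode_iff hn hg.symm⟩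

/-- A codeword is g p with deg p < deg h, because its degree is below n = deg g + deg h. -/
theorem finrank_cyclicCode_le {h : F[X]} (hn : n ≠ 0) (hdvd : h ∣ X ^ n - 1) :
    Module.finrank F (cyclicCode n h) ≤ h.natDegree := by
  obtain ⟨g, hg⟩ := hdvd
  rw [mul_comm] at hg
  have hne : (X ^ n - 1 : F[X]) ≠ 0 := X_pow_sub_C_ne_zero (Nat.pos_of_ne_zero hn) (1 : F)
  have hg0 : g ≠ 0 := by rintro rfl; exact hne (by simpa using hg)
  have hh0 : h ≠ 0 := by rintro rfl; exact hne (by simpa using hg)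
  have hdeg : (n : WithBot ℕ) = g.degree + h.natDegree := by
    rw [← degree_eq_natDegree hh0, ← degree_mul, ← hg]
    exact (degree_X_pow_sub_C (Nat.pos_of_ne_zero hn) (1 : F)).symm
  have hle : (cyclicCode n h).map (wordPolyHom F n) ≤
      (degreeLT F h.natDegree).map (LinearMap.mulLeft F g) := by
    rintro _ ⟨c, hc, rfl⟩
    obtain ⟨p, hp⟩ := (mem_cyclicCode_iff hn hg.symm c).1 hc
    refine ⟨p, ?_, hp.symm⟩
    have hlt := degree_wordPoly_lt c
    rw [hp, degree_mul, hdeg] at hlt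
    exact mem_degreeLT.2 (lt_of_add_lt_add_left hlt)
  have hfin : Module.Finite F (degreeLT F h.natDegree) :=
    Module.Finite.equiv (degreeLTEquiv F h.natDegree).symm
  calc Module.finrank F (cyclicCode n h)
      = Module.finrank F ((cyclicCode n h).map (wordPolyHom F n)) :=
        (Submodule.equivMapOfInjective _ wordPolyHom_injective _).finrank_eq
    _ ≤ Module.finrank F ((degreeLT F h.natDegree).map (LinearMap.mulLeft F g)) :=
        Submodule.finrank_mono hle
    _ ≤ Module.finrank F (degreeLT F h.natDegree) := Submodule.finrank_map_le _ _
    _ = h.natDegree := by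
        rw [(degreeLTEquiv F h.natDegree).finrank_eq, Module.finrank_fin_fun]

end CyclicCode

/-! ### Weights and distances -/

section Weights

variable {F : Type*} [Field F] [DecidableEq F] {n : ℕ}

theorem setOf_hammingDist_eq_nonzeroWeights (D : Submodule F (Fin n → F)) :
    {w | ∃ x ∈ D, ∃ y ∈ D, x ≠ y ∧ hammingDist x y = w} = nonzeroWeights D := by
  ext w
  constructor
  · rintro ⟨x, hx, y, hy, hxy, rfl⟩
    exact ⟨-x + y, D.add_mem (D.neg_mem hx) hy, by rwa [ne_eq, neg_add_eq_zero],
      (hammingDist_eq_hammingNorm x y).symm⟩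
  · rintro ⟨c, hc, hc0, rfl⟩
    exact ⟨c, hc, 0, D.zero_mem, hc0, hammingDist_zero_right c⟩

theorem weightCount_eq_zero_iff [Finite F] (D : Submodule F (Fin n → F)) (w : ℕ) :
    weightCount D w = 0 ↔ ∀ c ∈ D, hammingNorm c ≠ w := by
  rw [weightCount, Set.ncard_eq_zero (Set.toFinite _), Set.eq_empty_iff_forall_notMem]
  simp

theorem hammingNorm_mul {ε : Fin n → F} (hε : ∀ i, ε i ≠ 0) (y : Fin n → F) :
    hammingNorm (ε * y) = hammingNorm y := by
  simp [hammingNorm, hε]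

end Weights

/-! ### Dimension of the dual code -/

section Dual

variable {F : Type*} [Field F] {n : ℕ}

theorem finrank_dualCode (D : Submodule F (Fin n → F)) :
    Module.finrank F (dualCode D) = n - Module.finrank F D := by
  have hmap : dualCode D = (Submodule.dualAnnihilator D).comap
      (dotProductEquiv F (Fin n)).toLinearMap := by
    ext x
    rw [Submodule.mem_comap, Submodule.mem_dualAnnihilator]
    exact forall₂_congr fun c _ => by rw [dotProduct_comm]; rfl
  have h := Subspace.finrank_add_finrank_dualAnnihilator_eq D
  rw [Module.finrank_fin_fun] at h
  rw [hmap, Submodule.comap_equiv_eq_map_symm, LinearEquiv.finrank_map_eq]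
  omega

end Dual

/-! ### Weights of affine functions on K* -/

section AffineTraceWord

variable {F K ι : Type*} [Field F] [Field K] [Algebra F K]

/-- The word `i ↦ ε i * (a + Tr (b * u i))` attached to a pair `(a, b)`: the values at the points
`u i` of an affine function on `K`, scaled by the multipliers `ε i`. -/
noncomputable def affineTraceWord (ε : ι → F) (u : ι → K) : F × K →ₗ[F] (ι → F) where
  toFun p i := ε i * (p.1 + Algebra.trace F K (p.2 * u i))
  map_add' p r := by
    ext i
    simp only [Prod.fst_add, Prod.snd_add, add_mul, map_add, Pi.add_apply]
    ring
  map_smul' s p := by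
    ext i
    simp only [Prod.smul_fst, Prod.smul_snd, smul_mul_assoc, map_smul, Pi.smul_apply, smul_eq_mul,
      RingHom.id_apply]
    ring

theorem affineTraceWord_apply (ε : ι → F) (u : ι → K) (a : F) (b : K) (i : ι) :
    affineTraceWord ε u (a, b) i = ε i * (a + Algebra.trace F K (b * u i)) := rfl

theorem card_index_eq [Fintype F] [Fintype K] [Fintype ι] (u : ι ≃ Kˣ) :
    Fintype.card ι = Fintype.card F ^ Module.finrank F K - 1 := by
  classical
  rw [Fintype.card_congr u, Fintype.card_units, Module.card_eq_pow_finrank (K := F) (V := K)]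

variable [Fintype F] [DecidableEq F] [Fintype K]

/-- A nonzero functional is onto F, and all its fibres have the same size. -/
theorem card_fiber_of_ne_zero {l : K →ₗ[F] F} (hl : l ≠ 0) (c : F) :
    Finset.card {x | l x = c} = Fintype.card F ^ (Module.finrank F K - 1) := by
  have hsurj : Function.Surjective l := LinearMap.surjective hl
  have hsum : ∑ d : F, Finset.card {x | l x = d} = Fintype.card K :=
    (Finset.card_eq_sum_card_fiberwise (f := l) (t := Finset.univ) fun _ _ => by simp).symm
  rw [Finset.sum_congr rfl fun d _ => AddMonoidHom.card_fiber_eq_of_mem_range l (hsurj d) (hsurj c),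
    Finset.sum_const, Finset.card_univ, smul_eq_mul,
    Module.card_eq_pow_finrank (K := F) (V := K)] at hsum
  have hpos : 0 < Module.finrank F K := Module.finrank_pos
  refine Nat.eq_of_mul_eq_mul_left (Fintype.card_pos (α := F)) ?_
  rw [hsum, ← pow_succ', Nat.sub_add_cancel hpos]

theorem exists_trace_mul_ne_zero {b : K} (hb : b ≠ 0) : ∃ x, Algebra.trace F K (b * x) ≠ 0 := by
  have htr := (traceForm_nondegenerate F K).1 b
  simp_rw [Algebra.traceForm_apply] at htr
  by_contra! hf
  exact hb (htr hf)

theorem card_trace_mul_eq {b : K} (hb : b ≠ 0) (c : F) :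
    Finset.card {x | Algebra.trace F K (b * x) = c} =
      Fintype.card F ^ (Module.finrank F K - 1) := by
  refine card_fiber_of_ne_zero (l := Algebra.trace F K ∘ₗ LinearMap.mulLeft F b) ?_ c
  obtain ⟨x, hx⟩ := exists_trace_mul_ne_zero (F := F) hb
  exact fun h => hx (LinearMap.congr_fun h x)

variable [Fintype ι] {ε : ι → F} (u : ι ≃ Kˣ)

theorem hammingNorm_affineTraceWord_zero_right (hε : ∀ i, ε i ≠ 0) {a : F} (ha : a ≠ 0) :
    hammingNorm (affineTraceWord ε (fun i => (u i : K)) (a, 0)) =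
      Fintype.card F ^ Module.finrank F K - 1 := by
  rw [← card_index_eq (F := F) u, hammingNorm, Finset.filter_true_of_mem, Finset.card_univ]
  intro i _
  simp [affineTraceWord_apply, hε i, ha]

/-- The zeros of the word are the nonzero points of the hyperplane Tr(bx) = -a. It has q^(k-1)
points, and contains the missing point 0 exactly when a = 0. -/
theorem hammingNorm_affineTraceWord (hε : ∀ i, ε i ≠ 0) (a : F) {b : K} (hb : b ≠ 0) :
    hammingNorm (affineTraceWord ε (fun i => (u i : K)) (a, b)) =
      Fintype.card F ^ (Module.finrank F K - 1) * (Fintype.card F - 1) -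
        if a = 0 then 0 else 1 := by
  classical
  set q := Fintype.card F with hq
  set k := Module.finrank F K with hk
  set c := affineTraceWord ε (fun i => (u i : K)) (a, b) with hc
  have hzero : Finset.card {i | ¬ c i ≠ 0} =
      Finset.card {x : K | Algebra.trace F K (b * x) = -a ∧ x ≠ 0} := by
    refine Finset.card_nbij (fun i => (u i : K)) ?_ ?_ ?_
    · intro i hi
      simp only [Finset.coe_filter, Finset.mem_univ, true_and, Set.mem_ofPred_eq, not_not, hc,
        affineTraceWord_apply, mul_eq_zero, hε i, false_or] at hi ⊢
      exact ⟨eq_neg_of_add_eq_zero_right hi, (u i).ne_zero⟩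
    · intro i _ j _ hij
      exact u.injective (Units.ext hij)
    · intro x hx
      simp only [Finset.coe_filter, Finset.mem_univ, true_and, Set.mem_ofPred_eq] at hx
      refine ⟨u.symm (Units.mk0 x hx.2), ?_, by simp⟩
      simp [hc, affineTraceWord_apply, hx.1]
  have hsplit := Finset.card_filter_add_card_filter_not 
    (s := ({x : K | Algebra.trace F K (b * x) = -a} : Finset K)) (fun x => x ≠ 0)
  rw [Finset.filter_filter, Finset.filter_filter, card_trace_mul_eq hb] at hsplit
  have hpt : Finset.card {x : K | Algebra.trace F K (b * x) = -a ∧ ¬ x ≠ 0} =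
      if a = 0 then 1 else 0 := by
    split_ifs with ha
    · rw [Finset.card_eq_one]
      refine ⟨0, ?_⟩
      ext x
      simp only [Finset.mem_filter, Finset.mem_univ, true_and, not_not, Finset.mem_singleton, ha]
      exact ⟨fun h => h.2, by rintro rfl; simp⟩
    · rw [Finset.card_eq_zero, Finset.filter_eq_empty_iff]
      rintro x - ⟨h, hx⟩
      rw [not_not] at hx
      subst hx
      simp only [mul_zero, map_zero] at h
      exact ha (neg_eq_zero.1 h.symm)
  have htot := Finset.card_filter_add_card_filter_not (s := (Finset.univ : Finset ι))
    (fun i => c i ≠ 0)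
  rw [Finset.card_univ, card_index_eq (F := F) u, hzero] at htot
  rw [hpt] at hsplit
  change hammingNorm c + _ = _ at htot
  have hpow : q ^ k = q ^ (k - 1) * (q - 1) + q ^ (k - 1) := by
    have hpos : 0 < k := Module.finrank_pos
    have hq0 : 0 < q := Fintype.card_pos
    calc q ^ k = q ^ (k - 1) * q := by rw [← pow_succ, Nat.sub_add_cancel hpos]
      _ = q ^ (k - 1) * ((q - 1) + 1) := by rw [Nat.sub_add_cancel hq0]
      _ = _ := by ring
  rw [← hq, ← hk, hpow] at htot
  rw [← hq, ← hk] at hsplit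
  have hone : 0 < q ^ (k - 1) := pow_pos Fintype.card_pos _
  split_ifs at hsplit ⊢ <;> omega

/-- With W = q^(k-1)(q-1), this bound and the next give 0 < W - 1 < W < q^k - 1, so the four
possible weights are distinct. -/
theorem two_le_pow_mul_pred {q k : ℕ} (hq : 2 ≤ q) (hk : 1 < k) : 2 ≤ q ^ (k - 1) * (q - 1) :=
  calc 2 ≤ q := hq
    _ ≤ q ^ (k - 1) := Nat.le_self_pow (by omega) q
    _ ≤ q ^ (k - 1) * (q - 1) := Nat.le_mul_of_pos_right _ (by omega)

theorem pow_mul_pred_lt {q k : ℕ} (hq : 2 ≤ q) (hk : 1 < k) :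
    q ^ (k - 1) * (q - 1) < q ^ k - 1 := by
  have hpow : q ^ k = q ^ (k - 1) * (q - 1) + q ^ (k - 1) := by
    calc q ^ k = q ^ (k - 1) * q := by rw [← pow_succ, Nat.sub_add_cancel (by omega)]
      _ = q ^ (k - 1) * ((q - 1) + 1) := by rw [Nat.sub_add_cancel (by omega)]
      _ = _ := by ring
  have h2 : q ≤ q ^ (k - 1) := Nat.le_self_pow (by omega) q
  omega

/-- Every nonzero pair gives a word of positive weight. -/
theorem affineTraceWord_injective (hε : ∀ i, ε i ≠ 0) (hk : 1 < Module.finrank F K) :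
    Function.Injective (affineTraceWord ε (fun i => (u i : K))) := by
  have h2 := two_le_pow_mul_pred (Fintype.one_lt_card (α := F)) hk
  have h3 := pow_mul_pred_lt (Fintype.one_lt_card (α := F)) hk
  rw [injective_iff_map_eq_zero]
  rintro ⟨a, b⟩ hp
  have hnorm := hammingNorm_eq_zero.2 hp
  by_cases hb : b = 0
  · subst hb
    by_cases ha : a = 0
    · rw [ha]; rfl
    · rw [hammingNorm_affineTraceWord_zero_right u hε ha] at hnorm
      omega
  · rw [hammingNorm_affineTraceWord u hε a hb] at hnorm
    split_ifs at hnorm <;> omega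

theorem hammingNorm_affineTraceWord_eq_pred_iff (hε : ∀ i, ε i ≠ 0)
    (hk : 1 < Module.finrank F K) (p : F × K) :
    hammingNorm (affineTraceWord ε (fun i => (u i : K)) p) =
      Fintype.card F ^ (Module.finrank F K - 1) * (Fintype.card F - 1) - 1 ↔
        p.1 ≠ 0 ∧ p.2 ≠ 0 := by
  have h2 := two_le_pow_mul_pred (Fintype.one_lt_card (α := F)) hk
  have h3 := pow_mul_pred_lt (Fintype.one_lt_card (α := F)) hk
  obtain ⟨a, b⟩ := p
  by_cases hb : b = 0
  · subst hb
    by_cases ha : a = 0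
    · subst ha
      have h0 : affineTraceWord ε (fun i => (u i : K)) (0, 0) = 0 := map_zero _
      simp only [h0, hammingNorm_zero, ne_eq, not_true_eq_false, and_self, iff_false]
      omega
    · simp only [hammingNorm_affineTraceWord_zero_right u hε ha, ne_eq, not_true_eq_false,
        and_false, iff_false]
      omega
  · rw [hammingNorm_affineTraceWord u hε a hb]
    split_ifs with ha <;> simp [ha, hb]
    omega

theorem hammingNorm_affineTraceWord_eq_iff (hε : ∀ i, ε i ≠ 0)
    (hk : 1 < Module.finrank F K) (p : F × K) :
    hammingNorm (affineTraceWord ε (fun i => (u i : K)) p) =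
      Fintype.card F ^ (Module.finrank F K - 1) * (Fintype.card F - 1) ↔
        p.1 = 0 ∧ p.2 ≠ 0 := by
  have h2 := two_le_pow_mul_pred (Fintype.one_lt_card (α := F)) hk
  have h3 := pow_mul_pred_lt (Fintype.one_lt_card (α := F)) hk
  obtain ⟨a, b⟩ := p
  by_cases hb : b = 0
  · subst hb
    by_cases ha : a = 0
    · subst ha
      have h0 : affineTraceWord ε (fun i => (u i : K)) (0, 0) = 0 := map_zero _
      simp only [h0, hammingNorm_zero, ne_eq, not_true_eq_false, and_false, iff_false]
      omega
    · simp only [hammingNorm_affineTraceWord_zero_right u hε ha, ne_eq, not_true_eq_false,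
        and_false, iff_false]
      omega
  · rw [hammingNorm_affineTraceWord u hε a hb]
    split_ifs with ha <;> simp [ha, hb]
    omega

theorem hammingNorm_affineTraceWord_eq_length_iff (hε : ∀ i, ε i ≠ 0)
    (hk : 1 < Module.finrank F K) (p : F × K) :
    hammingNorm (affineTraceWord ε (fun i => (u i : K)) p) =
      Fintype.card F ^ Module.finrank F K - 1 ↔ p.1 ≠ 0 ∧ p.2 = 0 := by
  have h2 := two_le_pow_mul_pred (Fintype.one_lt_card (α := F)) hk
  have h3 := pow_mul_pred_lt (Fintype.one_lt_card (α := F)) hk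
  obtain ⟨a, b⟩ := p
  by_cases hb : b = 0
  · subst hb
    by_cases ha : a = 0
    · subst ha
      have h0 : affineTraceWord ε (fun i => (u i : K)) (0, 0) = 0 := map_zero _
      simp only [h0, hammingNorm_zero, ne_eq, not_true_eq_false, false_and, iff_false]
      omega
    · simp [hammingNorm_affineTraceWord_zero_right u hε ha, ha]
  · rw [hammingNorm_affineTraceWord u hε a hb]
    simp only [hb, and_false, iff_false]
    split_ifs with ha <;> omega

end AffineTraceWord

section Range

variable {F V : Type*} [Field F] [DecidableEq F] [AddCommGroup V] [Module F V] {n : ℕ}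

theorem weightCount_range {f : V →ₗ[F] (Fin n → F)} (hf : Function.Injective f) (w : ℕ) :
    weightCount f.range w = {p | hammingNorm (f p) = w}.ncard := by
  rw [weightCount, ← Set.ncard_image_of_injective _ hf]
  congr 1
  ext c
  constructor
  · rintro ⟨⟨p, rfl⟩, hp⟩
    exact ⟨p, hp, rfl⟩
  · rintro ⟨p, hp, rfl⟩
    exact ⟨⟨p, rfl⟩, hp⟩

end Range

/-! ### Affine relations of weight at most three -/

section AffineRelation

variable {F K ι : Type*} [Field F] [Field K] [Algebra F K] [Fintype ι]

/-- The coefficients `z` of an affine relation between the points `u i`. -/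
def IsAffineRelation (u : ι → K) (z : ι → F) : Prop :=
  ∑ i, z i = 0 ∧ ∑ i, z i • u i = 0

theorem IsAffineRelation.sub {u : ι → K} {z z' : ι → F} (hz : IsAffineRelation u z)
    (hz' : IsAffineRelation u z') : IsAffineRelation u (z - z') := by
  constructor
  · simp [Finset.sum_sub_distrib, hz.1, hz'.1]
  · simp [sub_smul, Finset.sum_sub_distrib, hz.2, hz'.2]

/-- Besides i, only the index of the point -(s/t) u_i is excluded. -/
theorem card_second_point [DecidableEq ι] (u : ι ≃ Kˣ) (s t : F) (hs : s ≠ 0)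
    (ht : t ≠ 0) (hst : s + t ≠ 0) (i : ι)
    [DecidablePred fun j => j ≠ i ∧ s • (u i : K) + t • (u j : K) ≠ 0] :
    Finset.card {j | j ≠ i ∧ s • (u i : K) + t • (u j : K) ≠ 0} = Fintype.card ι - 2 := by
  have hne : -((t⁻¹ * s) • (u i : K)) ≠ 0 :=
    neg_ne_zero.2 (smul_ne_zero (mul_ne_zero (inv_ne_zero ht) hs) (u i).ne_zero)
  set j₀ := u.symm (Units.mk0 _ hne) with hj₀
  have huj₀ : (u j₀ : K) = -((t⁻¹ * s) • (u i : K)) := by simp [hj₀]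
  have hiff : ∀ j, s • (u i : K) + t • (u j : K) = 0 ↔ j = j₀ := by
    intro j
    have : s • (u i : K) + t • (u j : K) = t • ((u j : K) - u j₀) := by
      rw [huj₀, sub_neg_eq_add, smul_add, smul_smul, ← mul_assoc, mul_inv_cancel₀ ht, one_mul,
        add_comm]
    rw [this, smul_eq_zero, or_iff_right ht, sub_eq_zero, Units.val_inj, u.apply_eq_iff_eq]
  -- Equality would give (s + t) u_i = 0; the two excluded indices are therefore distinct.
  have hij : j₀ ≠ i := by
    intro h
    have := (hiff i).2 h.symm
    rw [← add_smul, smul_eq_zero] at this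
    exact this.elim hst (u i).ne_zero
  have hset : ({j | j ≠ i ∧ s • (u i : K) + t • (u j : K) ≠ 0} : Finset ι) = {j₀, i}ᶜ := by
    ext j
    simp only [Finset.mem_filter_univ, Finset.mem_compl, Finset.mem_insert,
      Finset.mem_singleton, ne_eq, hiff]
    tauto
  rw [hset, Finset.card_compl, Finset.card_pair hij]

variable [DecidableEq F]

/-- Two distinct points are affinely independent. -/
theorem IsAffineRelation.eq_zero_of_hammingNorm_le_two {u : ι → K} (hu : Function.Injective u)
    {z : ι → F} (hz : IsAffineRelation u z) (hw : hammingNorm z ≤ 2) : z = 0 := by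
  classical
  have hsum : ∑ i with z i ≠ 0, z i = 0 := by
    rw [Finset.sum_filter_ne_zero]; exact hz.1
  have hsum' : ∑ i with z i ≠ 0, z i • u i = 0 := by
    rw [← hz.2]
    refine Finset.sum_subset (Finset.filter_subset _ _) fun i _ hi => ?_
    rw [Finset.mem_filter_univ, not_not] at hi
    rw [hi, zero_smul]
  rw [← hammingNorm_eq_zero]
  have hcases : hammingNorm z = 0 ∨ hammingNorm z = 1 ∨ hammingNorm z = 2 := by omega
  rcases hcases with h | h | h
  · exact h
  · obtain ⟨i, hi⟩ := Finset.card_eq_one.1 h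
    have hmem : i ∈ ({i | z i ≠ 0} : Finset ι) := by rw [hi]; simp
    rw [hi, Finset.sum_singleton] at hsum
    exact absurd hsum (Finset.mem_filter_univ i |>.1 hmem)
  · obtain ⟨i, j, hij, hs⟩ := Finset.card_eq_two.1 h
    have hmem : i ∈ ({i | z i ≠ 0} : Finset ι) := by rw [hs]; simp
    rw [hs, Finset.sum_pair hij] at hsum hsum'
    rw [eq_neg_of_add_eq_zero_right hsum, neg_smul, ← sub_eq_add_neg, ← smul_sub,
      smul_eq_zero, sub_eq_zero] at hsum'
    rcases hsum' with h0 | h0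
    · exact absurd h0 (Finset.mem_filter_univ i |>.1 hmem)
    · exact absurd (hu h0) hij

variable [DecidableEq ι]

theorem pair_subset_support {z : ι → F} {i j : ι} (hi : z i ≠ 0) (hj : z j ≠ 0) :
    ({i, j} : Finset ι) ⊆ Finset.univ.filter fun x => z x ≠ 0 := by
  intro x hx
  simp only [Finset.mem_insert, Finset.mem_singleton] at hx
  rcases hx with rfl | rfl <;> simpa

theorem card_support_sdiff_pair {z : ι → F} {i j : ι} (hij : i ≠ j) (hz : hammingNorm z = 3)
    (hi : z i ≠ 0) (hj : z j ≠ 0) :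
    ((Finset.univ.filter fun x => z x ≠ 0) \ {i, j}).card = 1 := by
  rw [Finset.card_sdiff_of_subset (pair_subset_support hi hj), Finset.card_pair hij]
  change hammingNorm z - 2 = 1
  omega

variable (u : ι ≃ Kˣ)

/-- Two weights and two points determine the third point of an affine relation of weight three. -/
theorem exists_isAffineRelation {s t : F} (hs : s ≠ 0) (ht : t ≠ 0) (hst : s + t ≠ 0) {i j : ι}
    (hij : j ≠ i) (h0 : s • (u i : K) + t • (u j : K) ≠ 0) :
    ∃ z : ι → F, IsAffineRelation (fun i => (u i : K)) z ∧ hammingNorm z = 3 ∧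
      z i = s ∧ z j = t := by
  have hne : (s + t)⁻¹ • (s • (u i : K) + t • (u j : K)) ≠ 0 :=
    smul_ne_zero (inv_ne_zero hst) h0
  -- The third point is the weighted mean of the first two; `h0` keeps it inside K*.
  set l := u.symm (Units.mk0 _ hne) with hl
  have hul : (s + t) • (u l : K) = s • (u i : K) + t • (u j : K) := by
    simp only [hl, Equiv.apply_symm_apply, Units.val_mk0]
    rw [smul_smul, mul_inv_cancel₀ hst, one_smul]
  have hdiff : (u j : K) - u i ≠ 0 := by
    rw [sub_ne_zero, ne_eq, Units.val_inj, u.apply_eq_iff_eq]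
    exact hij
  have hli : l ≠ i := by
    intro h
    rw [h, add_smul, add_right_inj, ← sub_eq_zero, ← smul_sub, smul_eq_zero, ← neg_sub,
      neg_eq_zero] at hul
    exact hul.elim ht hdiff
  have hlj : l ≠ j := by
    intro h
    rw [h, add_smul, add_left_inj, ← sub_eq_zero, ← smul_sub, smul_eq_zero] at hul
    exact hul.elim hs hdiff
  refine ⟨Pi.single i s + Pi.single j t + Pi.single l (-(s + t)), ⟨?_, ?_⟩, ?_, ?_, ?_⟩
  · simp [Finset.sum_add_distrib]
  · simp only [Pi.add_apply, add_smul, Finset.sum_add_distrib, Pi.single_apply, ite_smul,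
      zero_smul, Finset.sum_ite_eq', Finset.mem_univ, if_true, neg_smul]
    rw [← add_smul, hul, add_neg_cancel]
  · have hset : ({x | (Pi.single i s + Pi.single j t + Pi.single l (-(s + t)) : ι → F) x ≠ 0} :
        Finset ι) = {i, j, l} := by
      ext x
      simp only [Finset.mem_filter_univ, Finset.mem_insert, Finset.mem_singleton, Pi.add_apply,
        Pi.single_apply]
      by_cases hxi : x = i
      · subst hxi; simp [hij.symm, hli.symm, hs]
      · by_cases hxj : x = j
        · subst hxj; simp [hij, hlj.symm, ht]
        · by_cases hxl : x = l
          · subst hxl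
            simp only [hli, hlj, if_false, if_true, zero_add, or_true, iff_true, neg_ne_zero]
            exact hst
          · simp [hxi, hxj, hxl]
    rw [hammingNorm, hset]
    exact Finset.card_eq_three.2 ⟨i, j, l, hij.symm, hli.symm, hlj.symm, rfl⟩
  · simp [hij.symm, hli.symm]
  · simp [hij, hlj.symm]

/-- The affine relations of weight three, counted with the ordered pairs in their support. -/
theorem six_mul_ncard_isAffineRelation [Fintype F] :
    6 * {z : ι → F | IsAffineRelation (fun i => (u i : K)) z ∧ hammingNorm z = 3}.ncard =
      (Fintype.card F - 1) * ((Fintype.card F - 2) *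
        (Fintype.card ι * (Fintype.card ι - 2))) := by
  classical
  have hinj : Function.Injective fun i => (u i : K) := Units.val_injective.comp u.injective
  set W : Finset (ι → F) := {z | IsAffineRelation (fun i => (u i : K)) z ∧ hammingNorm z = 3}
    with hW
  have hWcard : {z : ι → F | IsAffineRelation (fun i => (u i : K)) z ∧ hammingNorm z = 3}.ncard
      = W.card := by
    rw [← Set.ncard_coe_finset]; simp [hW]
  -- Double count: `T` marks an ordered pair in the support of each relation, 6 ways each. `S` lists
  -- the two coefficients and two points so marked, which determine the relation.
  let T : Finset (Σ _ : ι → F, ι × ι) :=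
    W.sigma fun z => (Finset.univ.filter fun i => z i ≠ 0).offDiag
  let S : Finset (Σ _ : F, Σ _ : F, Σ _ : ι, ι) :=
    ({0}ᶜ : Finset F).sigma fun s => ({0, -s}ᶜ : Finset F).sigma fun t =>
      (Finset.univ : Finset ι).sigma fun i =>
        {j | j ≠ i ∧ s • (u i : K) + t • (u j : K) ≠ 0}
  have hT : T.card = 6 * W.card := by
    rw [Finset.card_sigma, Finset.sum_congr rfl (g := fun _ => 6), Finset.sum_const, smul_eq_mul,
      mul_comm]
    intro z hz
    have h3 : (Finset.univ.filter fun i => z i ≠ 0).card = 3 := ((Finset.mem_filter_univ z).1 hz).2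
    rw [Finset.offDiag_card, h3]
  have hS : S.card = (Fintype.card F - 1) * ((Fintype.card F - 2) *
        (Fintype.card ι * (Fintype.card ι - 2))) := by
    rw [Finset.card_sigma, Finset.sum_congr rfl, Finset.sum_const, Finset.card_compl,
      Finset.card_singleton, smul_eq_mul]
    intro s hs
    have hs0 : s ≠ 0 := by simpa using hs
    rw [Finset.card_sigma, Finset.sum_congr rfl, Finset.sum_const, Finset.card_compl,
      Finset.card_pair (neg_ne_zero.2 hs0).symm, smul_eq_mul]
    intro t ht
    simp only [Finset.mem_compl, Finset.mem_insert, Finset.mem_singleton, not_or] at ht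
    rw [Finset.card_sigma, Finset.sum_congr rfl, Finset.sum_const, Finset.card_univ, smul_eq_mul]
    intro i _
    exact card_second_point u s t hs0 ht.1 (fun h => ht.2 (eq_neg_of_add_eq_zero_right h)) i
  rw [hWcard, ← hT, ← hS]
  refine Finset.card_bij (fun x _ => ⟨x.1 x.2.1, x.1 x.2.2, x.2.1, x.2.2⟩) ?_ ?_ ?_
  · rintro ⟨z, i, j⟩ hx
    simp only [T, Finset.mem_sigma, Finset.mem_offDiag, Finset.mem_filter_univ, hW] at hx
    obtain ⟨⟨hz, hz3⟩, hi, hj, hij⟩ := hx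
    obtain ⟨l, hl⟩ : ∃ l, ({i | z i ≠ 0} : Finset ι) = {i, j, l} ∧ l ≠ i ∧ l ≠ j := by
      have hsub := pair_subset_support hi hj
      have hone := card_support_sdiff_pair hij hz3 hi hj
      obtain ⟨l, hl⟩ := Finset.card_eq_one.1 hone
      have hmem : l ∈ ({i | z i ≠ 0} : Finset ι) \ {i, j} := by rw [hl]; simp
      simp only [Finset.mem_sdiff, Finset.mem_insert, Finset.mem_singleton, not_or] at hmem
      refine ⟨l, ?_, hmem.2⟩
      rw [← Finset.sdiff_union_of_subset hsub, hl]
      ext x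
      simp only [Finset.mem_union, Finset.mem_insert, Finset.mem_singleton]
      tauto
    obtain ⟨hl, hli, hlj⟩ := hl
    have hzl : z l ≠ 0 := by
      have : l ∈ ({i | z i ≠ 0} : Finset ι) := by rw [hl]; simp
      simpa using this
    have hsum : z i + (z j + z l) = 0 := by
      have h := hz.1
      rw [← Finset.sum_filter_ne_zero, hl, Finset.sum_insert (by simp [hij, hli.symm]),
        Finset.sum_pair hlj.symm] at h
      exact h
    have hsum' : z i • (u i : K) + (z j • (u j : K) + z l • (u l : K)) = 0 := by
      have h := hz.2
      rw [← Finset.sum_subset (Finset.subset_univ ({i | z i ≠ 0} : Finset ι)), hl,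
        Finset.sum_insert (by simp [hij, hli.symm]), Finset.sum_pair hlj.symm] at h
      · exact h
      · intro x _ hx
        rw [Finset.mem_filter_univ, not_not] at hx
        rw [hx, zero_smul]
    simp only [S, Finset.mem_sigma, Finset.mem_compl, Finset.mem_insert, Finset.mem_singleton,
      not_or, Finset.mem_univ, true_and, Finset.mem_filter_univ]
    -- The two exclusions say that the third coefficient, respectively the third point, is nonzero.
    refine ⟨hi, ⟨hj, ?_⟩, hij.symm, ?_⟩
    · intro h
      rw [h] at hsum
      exact hzl (by simpa using hsum)
    · intro h
      rw [← add_assoc, h, zero_add, smul_eq_zero] at hsum'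
      exact hsum'.elim hzl (u l).ne_zero
  · rintro ⟨z, i, j⟩ hx ⟨z', i', j'⟩ hx' heq
    simp only [Sigma.mk.injEq, heq_eq_eq] at heq
    obtain ⟨h1, h2, rfl, rfl⟩ := heq
    simp only [T, Finset.mem_sigma, Finset.mem_offDiag, Finset.mem_filter_univ, hW] at hx hx'
    obtain ⟨⟨hz, hz3⟩, hi, hj, hij⟩ := hx
    obtain ⟨⟨hz', hz3'⟩, hi', hj', -⟩ := hx'
    -- The relations agree at i and j, so their difference lives on the two third points, and it is
    -- again a relation.
    suffices hammingNorm (z - z') ≤ 2 by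
      rw [sub_eq_zero.1 ((hz.sub hz').eq_zero_of_hammingNorm_le_two hinj this)]
    have hsub : ({x | (z - z') x ≠ 0} : Finset ι) ⊆
        (({x | z x ≠ 0} : Finset ι) \ {i, j}) ∪ (({x | z' x ≠ 0} : Finset ι) \ {i, j}) := by
      intro x hx
      simp only [Finset.mem_filter_univ, Pi.sub_apply, sub_ne_zero] at hx
      have hxi : x ≠ i := by rintro rfl; exact hx h1
      have hxj : x ≠ j := by rintro rfl; exact hx h2
      simp only [Finset.mem_union, Finset.mem_sdiff, Finset.mem_filter_univ, Finset.mem_insert,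
        Finset.mem_singleton, hxi, hxj, or_self, not_false_eq_true, and_true]
      by_contra! h
      exact hx (h.1.trans h.2.symm)
    refine (Finset.card_le_card hsub).trans ((Finset.card_union_le _ _).trans ?_)
    rw [card_support_sdiff_pair hij hz3 hi hj, card_support_sdiff_pair hij hz3' hi' hj']
  · rintro ⟨s, t, i, j⟩ hx
    simp only [S, Finset.mem_sigma, Finset.mem_compl, Finset.mem_insert, Finset.mem_singleton,
      not_or, Finset.mem_univ, true_and, Finset.mem_filter_univ] at hx
    obtain ⟨hs, ⟨ht, hst⟩, hij, h0⟩ := hx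
    obtain ⟨z, hz, hz3, hzi, hzj⟩ := exists_isAffineRelation u hs ht
      (fun h => hst (eq_neg_of_add_eq_zero_right h)) hij h0
    refine ⟨⟨z, i, j⟩, ?_, ?_⟩
    · simp only [T, Finset.mem_sigma, Finset.mem_offDiag, Finset.mem_filter_univ, hW]
      exact ⟨⟨hz, hz3⟩, by rwa [hzi], by rwa [hzj], hij.symm⟩
    · simp [hzi, hzj]

end AffineRelation

/-! ### The dual code as affine relations -/

section DualRange

variable {F K : Type*} [Field F] [Field K] [Algebra F K] [Finite F] [Finite K] {n : ℕ}
  {ε : Fin n → F}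

/-- With z = εy, the dot product with the word of (a, b) is a Σ z_i + Tr(b Σ z_i u_i). It vanishes
for all a and b only if both sums do, as the trace form is nondegenerate. -/
theorem mem_dualCode_range_iff (ε : Fin n → F) (u : Fin n → K) (y : Fin n → F) :
    y ∈ dualCode (affineTraceWord ε u).range ↔ IsAffineRelation u (ε * y) := by
  cases nonempty_fintype F
  cases nonempty_fintype K
  classical
  have hdot : ∀ a b, affineTraceWord ε u (a, b) ⬝ᵥ y =
      a * ∑ i, (ε * y) i + Algebra.trace F K (b * ∑ i, (ε * y) i • u i) := by
    intro a b
    simp only [dotProduct, affineTraceWord_apply, Finset.mul_sum, map_sum, mul_smul_comm, map_smul,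
      smul_eq_mul, ← Finset.sum_add_distrib, Pi.mul_apply]
    exact Finset.sum_congr rfl fun i _ => by ring
  constructor
  · intro h
    have h' : ∀ a b, a * ∑ i, (ε * y) i + Algebra.trace F K (b * ∑ i, (ε * y) i • u i) = 0 :=
      fun a b => (hdot a b).symm.trans (h _ ⟨(a, b), rfl⟩)
    refine ⟨by simpa using h' 1 0, ?_⟩
    by_contra hne
    obtain ⟨b, hb⟩ := exists_trace_mul_ne_zero (F := F) hne
    exact hb (by simpa [mul_comm] using h' 0 b)
  · rintro ⟨h1, h2⟩ _ ⟨⟨a, b⟩, rfl⟩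
    rw [hdot, h1, h2]
    simp

variable [DecidableEq F]

theorem eq_zero_of_mem_dualCode_range (hε : ∀ i, ε i ≠ 0) {u : Fin n → K}
    (hu : Function.Injective u) {y : Fin n → F} (hy : y ∈ dualCode (affineTraceWord ε u).range)
    (hw : hammingNorm y ≤ 2) : y = 0 := by
  rw [← hammingNorm_eq_zero, ← hammingNorm_mul hε, hammingNorm_eq_zero]
  exact ((mem_dualCode_range_iff ε u y).1 hy).eq_zero_of_hammingNorm_le_two hu
    (by rwa [hammingNorm_mul hε])

theorem six_mul_weightCount_dualCode_range (hε : ∀ i, ε i ≠ 0) (u : Fin n ≃ Kˣ) :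
    6 * weightCount (dualCode (affineTraceWord ε fun i => (u i : K)).range) 3 =
      (Nat.card F - 1) * ((Nat.card F - 2) * (n * (n - 2))) := by
  cases nonempty_fintype F
  have h := six_mul_ncard_isAffineRelation (F := F) u
  rw [Fintype.card_fin] at h
  rw [Nat.card_eq_fintype_card, ← h]
  congr 1
  have hinj : Function.Injective fun y : Fin n → F => ε * y := fun y y' hyy =>
    funext fun i => mul_left_cancel₀ (hε i) (congrFun hyy i)
  rw [weightCount, ← Set.ncard_image_of_injective _ hinj]
  congr 1
  ext z
  constructor
  · rintro ⟨y, ⟨hy, hy3⟩, rfl⟩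
    exact ⟨(mem_dualCode_range_iff _ _ _).1 hy, (hammingNorm_mul hε y).trans hy3⟩
  · rintro ⟨hz, hz3⟩
    have hzy : ε * (ε⁻¹ * z) = z := funext fun i => mul_inv_cancel_left₀ (hε i) (z i)
    refine ⟨ε⁻¹ * z, ⟨?_, ?_⟩, hzy⟩
    · rw [mem_dualCode_range_iff, hzy]
      exact hz
    · rw [← hammingNorm_mul hε, hzy]
      exact hz3

end DualRange

/-! ### Coprimality of the exponent and the Griesmer sum -/

section Arithmetic

variable {q k : ℕ}

theorem Delta_eq_geom_sum (hq : 2 ≤ q) (k : ℕ) : Delta q k = ∑ i ∈ Finset.range k, q ^ i :=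
  (Nat.geomSum_eq hq k).symm

theorem Delta_mul_sub_one (hq : 2 ≤ q) (k : ℕ) :
    (Delta q k : ℤ) * ((q : ℤ) - 1) = (q : ℤ) ^ k - 1 := by
  rw [Delta_eq_geom_sum hq]
  push_cast
  exact geom_sum_mul _ _

/-- Δ is a sum of k powers of q, each congruent to 1 mod q - 1. -/
theorem sub_one_dvd_Delta_sub (hq : 2 ≤ q) (k : ℕ) : (q : ℤ) - 1 ∣ (Delta q k : ℤ) - k := by
  rw [Delta_eq_geom_sum hq]
  have h : ((∑ i ∈ Finset.range k, q ^ i : ℕ) : ℤ) - k =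
      ∑ i ∈ Finset.range k, ((q : ℤ) ^ i - 1) := by
    rw [Finset.sum_sub_distrib]; simp
  rw [h]
  exact Finset.dvd_sum fun i _ => by simpa using sub_dvd_pow_sub_pow (q : ℤ) 1 i

theorem isCoprime_pow_sub_one (hq : 2 ≤ q) {e₁ e₂ : ℤ}
    (h₁ : Int.gcd ((q : ℤ) - 1) ((k : ℤ) * e₁ - e₂) = 1) (h₂ : Int.gcd (Delta q k : ℤ) e₂ = 1) :
    IsCoprime ((q : ℤ) ^ k - 1) (e₂ - Delta q k * e₁) := by
  rw [← Int.isCoprime_iff_gcd_eq_one] at h₁ h₂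
  rw [← Delta_mul_sub_one hq]
  refine IsCoprime.mul_left ?_ ?_
  · have := h₂.add_mul_left_right (-e₁)
    rwa [mul_neg, ← sub_eq_add_neg] at this
  · obtain ⟨t, ht⟩ := sub_one_dvd_Delta_sub hq k
    have := h₁.neg_right.add_mul_left_right (-(t * e₁))
    have heq : e₂ - Delta q k * e₁ = -((k : ℤ) * e₁ - e₂) + ((q : ℤ) - 1) * -(t * e₁) := by
      linear_combination (-e₁) * ht
    rwa [heq]

/-- The term i = 0 is d itself, the middle terms (q - 1) q^j add up to q^(k-1) - 1, and the last is
1. -/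
theorem griesmer_sum (hq : 2 ≤ q) (hk : 1 < k) :
    q ^ k - 1 = ∑ i ∈ Finset.range (k + 1),
      ⌈((q ^ (k - 1) * (q - 1) - 1 : ℕ) : ℚ) / (q : ℚ) ^ i⌉₊ := by
  obtain ⟨m, rfl⟩ : ∃ m, k = m + 1 := ⟨k - 1, by omega⟩
  have h2 := two_le_pow_mul_pred hq hk
  simp only [Nat.add_sub_cancel] at h2 ⊢
  set d := q ^ m * (q - 1) - 1 with hd
  have hq0 : (0 : ℚ) < q := by exact_mod_cast (by omega : 0 < q)
  have hd' : (d : ℚ) = (q : ℚ) ^ m * ((q - 1 : ℕ) : ℚ) - 1 := by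
    rw [hd, Nat.cast_sub (by omega)]; push_cast; ring
  -- Because of the -1 in d, the quotient falls short of this integer by 1/q^(i+1) < 1.
  have hmid : ∀ i ∈ Finset.range m, ⌈(d : ℚ) / (q : ℚ) ^ (i + 1)⌉₊ =
      q ^ (m - 1 - i) * (q - 1) := by
    intro i hi
    have him : i < m := Finset.mem_range.1 hi
    have hne : q ^ (m - 1 - i) * (q - 1) ≠ 0 :=
      mul_ne_zero (pow_ne_zero _ (by omega)) (by omega)
    have hsplit : (q : ℚ) ^ m = (q : ℚ) ^ (m - 1 - i) * (q : ℚ) ^ (i + 1) := by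
      rw [← pow_add]; congr 1; omega
    have hpos : (0 : ℚ) < (q : ℚ) ^ (i + 1) := pow_pos hq0 _
    have hone : (1 : ℚ) < (q : ℚ) ^ (i + 1) :=
      one_lt_pow₀ (by exact_mod_cast hq) (by omega)
    rw [Nat.ceil_eq_iff hne, lt_div_iff₀ hpos, div_le_iff₀ hpos, hd', hsplit,
      Nat.cast_sub (Nat.one_le_iff_ne_zero.2 hne)]
    push_cast
    constructor <;> nlinarith
  have hlast : ⌈(d : ℚ) / (q : ℚ) ^ (m + 1)⌉₊ = 1 := by
    have hpos : (0 : ℚ) < (q : ℚ) ^ (m + 1) := pow_pos hq0 _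
    rw [Nat.ceil_eq_iff one_ne_zero, lt_div_iff₀ hpos, div_le_iff₀ hpos]
    have hlt : d ≤ q ^ (m + 1) :=
      (Nat.sub_le _ _).trans (by rw [pow_succ]; exact Nat.mul_le_mul_left _ (Nat.sub_le _ _))
    refine ⟨?_, ?_⟩
    · simpa using (by omega : 0 < d)
    · rw [Nat.cast_one, one_mul]; exact_mod_cast hlt
  have hgeom : (∑ i ∈ Finset.range m, q ^ i) * (q - 1) = q ^ m - 1 := by
    have := Nat.geomSum_eq hq m
    rw [this, Nat.div_mul_cancel]
    simpa using Nat.sub_dvd_pow_sub_pow q 1 m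
  rw [Finset.sum_range_succ, hlast, Finset.sum_range_succ', Finset.sum_congr rfl hmid,
    Finset.sum_range_reflect (fun i => q ^ i * (q - 1)) m, ← Finset.sum_mul, hgeom, pow_zero,
    div_one, Nat.ceil_natCast, hd]
  have hpow : q ^ (m + 1) = q ^ m * (q - 1) + q ^ m := by
    calc q ^ (m + 1) = q ^ m * ((q - 1) + 1) := by rw [Nat.sub_add_cancel (by omega), pow_succ]
      _ = _ := by ring
  have : 0 < q ^ m := pow_pos (by omega) _
  omega

end Arithmetic

/-! ### Cyclic shifts and irreducibility -/

section Cyclic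

variable {F K : Type*} [Field F] [Field K] [Algebra F K] {n : ℕ}

theorem pow_finRotate {M : Type*} [Monoid M] {x : M} (hx : x ^ n = 1) (i : Fin n) :
    x ^ (finRotate n i : ℕ) = x ^ ((i : ℕ) + 1) := by
  obtain _ | m := n
  · exact i.elim0
  · rw [finRotate_apply, Fin.val_add_one]
    split_ifs with h
    · rw [h, Fin.val_last, hx, pow_zero]
    · rfl

/-- Powers of a generator of a finite cyclic group, with exponent prime to its order. -/
theorem bijective_zpow_pow {G : Type*} [Group G] [Finite G] {γ : G}
    (hγ : ∀ x : G, x ∈ Subgroup.zpowers γ) {n : ℕ} (hn : Nat.card G = n) {m : ℤ}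
    (hm : IsCoprime (n : ℤ) m) : Function.Bijective fun i : Fin n => (γ ^ m) ^ (i : ℕ) := by
  cases nonempty_fintype G
  have hord : orderOf γ = n := (orderOf_eq_card_of_forall_mem_zpowers hγ).trans hn
  rw [Fintype.bijective_iff_injective_and_card]
  refine ⟨fun i j hij => ?_, by rw [Fintype.card_fin, ← hn, Nat.card_eq_fintype_card]⟩
  simp only [← zpow_natCast, ← zpow_mul] at hij
  rw [zpow_eq_zpow_iff_modEq, hord, Int.modEq_iff_dvd, ← mul_sub] at hij
  have hdvd := hm.dvd_of_dvd_mul_left hij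
  have := Int.eq_zero_of_abs_lt_dvd hdvd (by rw [abs_lt]; omega)
  exact Fin.ext (by omega)

variable {δ : F} {β : K} {ε : Fin n → F} {u : Fin n → K}

theorem affineTraceWord_comp_finRotate (hδ : δ ^ n = 1) (hβ : β ^ n = 1)
    (h : ∀ a b i, affineTraceWord ε u (a, b) i =
      a * δ ^ (i : ℕ) + Algebra.trace F K (b * β ^ (i : ℕ))) (a : F) (b : K) :
    affineTraceWord ε u (a, b) ∘ finRotate n = affineTraceWord ε u (a * δ, b * β) := by
  ext i
  rw [Function.comp_apply, h, h, pow_finRotate hδ, pow_finRotate hβ, pow_succ', pow_succ',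
    mul_assoc, mul_assoc]

/-- A nonzero subspace of `K` stable under multiplication by a generator of `K` is everything. -/
theorem eq_top_of_mul_mem [FiniteDimensional F K] {β : K}
    (hβ : (minpoly F β⁻¹).natDegree = Module.finrank F K) {B : Submodule F K}
    (hB : ∀ b ∈ B, b * β ∈ B) {b : K} (hb : b ∈ B) (hb0 : b ≠ 0) : B = ⊤ := by
  have hpoly : ∀ p : F[X], ∀ b ∈ B, b * aeval β p ∈ B := by
    intro p
    induction p using Polynomial.induction_on' with
    | add p r hp hr =>
      intro b hb
      rw [map_add, mul_add]
      exact B.add_mem (hp b hb) (hr b hb)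
    | monomial m a =>
      intro b hb
      rw [aeval_monomial, ← Algebra.smul_def, mul_smul_comm]
      refine B.smul_mem a ?_
      induction m with
      | zero => simpa using hb
      | succ m ih => rw [pow_succ, ← mul_assoc]; exact hB _ ih
  -- The degree hypothesis concerns β⁻¹, the root of the parity-check polynomial; β and β⁻¹ generate
  -- the same field.
  have htop : Algebra.adjoin F {β} = ⊤ := by
    have h1 : IntermediateField.adjoin F {β⁻¹} = ⊤ :=
      (Field.primitive_element_iff_minpoly_natDegree_eq F β⁻¹).2 hβ
    have h2 : IntermediateField.adjoin F {β} = ⊤ := by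
      rw [eq_top_iff, ← h1, IntermediateField.adjoin_simple_le_iff]
      exact inv_mem (IntermediateField.mem_adjoin_simple_self F β)
    rw [← IntermediateField.adjoin_simple_toSubalgebra_of_isAlgebraic
      (Algebra.IsAlgebraic.isAlgebraic β), h2, IntermediateField.top_toSubalgebra]
  rw [eq_top_iff]
  intro c _
  have hc : b⁻¹ * c ∈ Algebra.adjoin F {β} := by rw [htop]; trivial
  rw [Algebra.adjoin_singleton_eq_range_aeval] at hc
  obtain ⟨p, hp⟩ := hc
  have := hpoly p b hb
  rwa [show aeval β p = b⁻¹ * c from hp, mul_inv_cancel_left₀ hb0] at this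

theorem isIrreducibleCyclicCode_of_finrank_eq_one {D : Submodule F (Fin n → F)}
    (hD : IsCyclicCode D) (h : Module.finrank F D = 1) : IsIrreducibleCyclicCode D := by
  refine ⟨hD, ?_, fun E _ hE => ?_⟩
  · rintro rfl
    simp at h
  · by_cases hE0 : Module.finrank F E = 0
    · exact Or.inl (Submodule.finrank_eq_zero.1 hE0)
    · exact Or.inr (Submodule.eq_of_le_of_finrank_le hE (by omega))

end Cyclic

/-! ### Error correction -/

section SingleError

variable {F : Type*} [Field F] [DecidableEq F] {n : ℕ}

theorem correctsErrors_one {D : Submodule F (Fin n → F)}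
    (h : ∀ c ∈ D, hammingNorm c ≤ 2 → c = 0) : CorrectsErrors D 1 := by
  intro y c hc c' hc' hyc hyc'
  have htri := hammingDist_triangle_left c c' y
  rw [hammingDist_eq_hammingNorm] at htri
  exact neg_add_eq_zero.1 (h _ (D.add_mem (D.neg_mem hc) hc') (by omega))

theorem not_correctsErrors_two {D : Submodule F (Fin n → F)} {c : Fin n → F} (hc : c ∈ D)
    (h3 : hammingNorm c = 3) : ¬ CorrectsErrors D 2 := by
  intro hcorr
  have hc0 : c ≠ 0 := by rintro rfl; simp at h3
  obtain ⟨i, hi⟩ := Function.ne_iff.1 hc0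
  -- Erasing one of the three nonzero entries of c gives a word at distance 1 from c and 2 from 0.
  refine hc0 (hcorr (Function.update c i 0) c hc 0 D.zero_mem ?_ ?_)
  · refine (Finset.card_le_card (t := {i}) fun j hj => ?_).trans (by simp)
    rw [Finset.mem_filter_univ] at hj
    by_contra hji
    exact hj (Function.update_of_ne (by simpa using hji) _ _)
  · rw [hammingDist_zero_right]
    have hsub : (Finset.univ.filter fun j => Function.update c i 0 j ≠ 0) ⊂
        Finset.univ.filter fun j => c j ≠ 0 := by
      rw [Finset.ssubset_iff_of_subset]
      · exact ⟨i, by simpa using hi, by simp⟩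
      · intro j hj
        rw [Finset.mem_filter_univ] at hj ⊢
        by_cases hji : j = i
        · subst hji; exact hi
        · rwa [Function.update_of_ne hji] at hj
    have hlt : hammingNorm (Function.update c i 0) < hammingNorm c := Finset.card_lt_card hsub
    omega

end SingleError

/-! ### Weight distributions -/

section Codes

variable {F K : Type*} [Field F] [Field K] [Algebra F K] [Fintype F] [DecidableEq F] [Fintype K]
  {n : ℕ} {ε : Fin n → F}

theorem nonzeroWeights_range_inl (hε : ∀ i, ε i ≠ 0) (u : Fin n ≃ Kˣ) :
    nonzeroWeights (affineTraceWord ε (fun i => (u i : K)) ∘ₗ LinearMap.inl F F K).range =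
      {Fintype.card F ^ Module.finrank F K - 1} := by
  ext w
  rw [Set.mem_singleton_iff]
  constructor
  · rintro ⟨_, ⟨a, rfl⟩, ha, rfl⟩
    refine hammingNorm_affineTraceWord_zero_right u hε ?_
    rintro rfl
    exact ha (map_zero _)
  · rintro rfl
    have hne : Fintype.card F ^ Module.finrank F K - 1 ≠ 0 := by
      have := Nat.one_lt_pow (Module.finrank_pos (R := F) (M := K)).ne'
        (Fintype.one_lt_card (α := F))
      omega
    have h1 := hammingNorm_affineTraceWord_zero_right u hε (one_ne_zero (α := F))
    refine ⟨_, ⟨1, rfl⟩, ?_, h1⟩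
    rw [← hammingNorm_ne_zero_iff]
    exact h1.trans_ne hne

theorem nonzeroWeights_range_inr (hε : ∀ i, ε i ≠ 0) (u : Fin n ≃ Kˣ)
    (hk : 1 < Module.finrank F K) :
    nonzeroWeights (affineTraceWord ε (fun i => (u i : K)) ∘ₗ LinearMap.inr F F K).range =
      {Fintype.card F ^ (Module.finrank F K - 1) * (Fintype.card F - 1)} := by
  have h2 := two_le_pow_mul_pred (Fintype.one_lt_card (α := F)) hk
  ext w
  rw [Set.mem_singleton_iff]
  constructor
  · rintro ⟨_, ⟨b, rfl⟩, hb, rfl⟩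
    refine (hammingNorm_affineTraceWord_eq_iff u hε hk (0, b)).2 ⟨rfl, ?_⟩
    rintro rfl
    exact hb (map_zero _)
  · rintro rfl
    have h1 := (hammingNorm_affineTraceWord_eq_iff u hε hk (0, 1)).2 ⟨rfl, one_ne_zero⟩
    refine ⟨_, ⟨1, rfl⟩, ?_, h1⟩
    rw [← hammingNorm_ne_zero_iff]
    exact h1.trans_ne (by omega)

theorem hammingNorm_affineTraceWord_mem (hε : ∀ i, ε i ≠ 0) (u : Fin n ≃ Kˣ)
    (hk : 1 < Module.finrank F K) {p : F × K} (hp : p ≠ 0) :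
    hammingNorm (affineTraceWord ε (fun i => (u i : K)) p) ∈
      ({Fintype.card F ^ (Module.finrank F K - 1) * (Fintype.card F - 1) - 1,
        Fintype.card F ^ (Module.finrank F K - 1) * (Fintype.card F - 1),
        Fintype.card F ^ Module.finrank F K - 1} : Set ℕ) := by
  simp only [Set.mem_insert_iff, Set.mem_singleton_iff,
    hammingNorm_affineTraceWord_eq_pred_iff u hε hk, hammingNorm_affineTraceWord_eq_iff u hε hk,
    hammingNorm_affineTraceWord_eq_length_iff u hε hk]
  have : ¬ (p.1 = 0 ∧ p.2 = 0) := fun h => hp (Prod.ext h.1 h.2)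
  tauto

theorem nonzeroWeights_range (hε : ∀ i, ε i ≠ 0) (u : Fin n ≃ Kˣ)
    (hk : 1 < Module.finrank F K) :
    nonzeroWeights (affineTraceWord ε (fun i => (u i : K))).range =
      {Fintype.card F ^ (Module.finrank F K - 1) * (Fintype.card F - 1) - 1,
        Fintype.card F ^ (Module.finrank F K - 1) * (Fintype.card F - 1),
        Fintype.card F ^ Module.finrank F K - 1} := by
  have h2 := two_le_pow_mul_pred (Fintype.one_lt_card (α := F)) hk
  have h3 := pow_mul_pred_lt (Fintype.one_lt_card (α := F)) hk
  refine Set.Subset.antisymm ?_ ?_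
  · rintro w ⟨_, ⟨p, rfl⟩, hp, rfl⟩
    refine hammingNorm_affineTraceWord_mem hε u hk ?_
    rintro rfl
    exact hp (map_zero _)
  · have key : ∀ p w, w ≠ 0 → hammingNorm (affineTraceWord ε (fun i => (u i : K)) p) = w →
        w ∈ nonzeroWeights (affineTraceWord ε (fun i => (u i : K))).range := fun p w hw h =>
      ⟨_, ⟨p, rfl⟩, hammingNorm_ne_zero_iff.1 (h.trans_ne hw), h⟩
    rintro w (rfl | rfl | rfl)
    · exact key (1, 1) _ (by omega) ((hammingNorm_affineTraceWord_eq_pred_iff u hε hk _).2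
        ⟨one_ne_zero, one_ne_zero⟩)
    · exact key (0, 1) _ (by omega) ((hammingNorm_affineTraceWord_eq_iff u hε hk _).2
        ⟨rfl, one_ne_zero⟩)
    · exact key (1, 0) _ (by omega) ((hammingNorm_affineTraceWord_eq_length_iff u hε hk _).2
        ⟨one_ne_zero, rfl⟩)

theorem ncard_compl_zero (V : Type*) [Zero V] [Finite V] :
    ({0}ᶜ : Set V).ncard = Nat.card V - 1 := by
  rw [Set.ncard_compl, Set.ncard_singleton]

theorem weightCount_range_pred (hε : ∀ i, ε i ≠ 0) (u : Fin n ≃ Kˣ)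
    (hk : 1 < Module.finrank F K) :
    weightCount (affineTraceWord ε (fun i => (u i : K))).range
        (Fintype.card F ^ (Module.finrank F K - 1) * (Fintype.card F - 1) - 1) =
      (Fintype.card F - 1) * (Fintype.card F ^ Module.finrank F K - 1) := by
  rw [weightCount_range (affineTraceWord_injective u hε hk)]
  have hset : {p : F × K | hammingNorm (affineTraceWord ε (fun i => (u i : K)) p) =
      Fintype.card F ^ (Module.finrank F K - 1) * (Fintype.card F - 1) - 1} =
      ({0}ᶜ : Set F) ×ˢ ({0}ᶜ : Set K) :=
    Set.ext fun p => hammingNorm_affineTraceWord_eq_pred_iff u hε hk p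
  rw [hset, Set.ncard_prod, ncard_compl_zero, ncard_compl_zero, Nat.card_eq_fintype_card,
    Nat.card_eq_fintype_card, Module.card_eq_pow_finrank (K := F) (V := K)]

theorem weightCount_range_middle (hε : ∀ i, ε i ≠ 0) (u : Fin n ≃ Kˣ)
    (hk : 1 < Module.finrank F K) :
    weightCount (affineTraceWord ε (fun i => (u i : K))).range
        (Fintype.card F ^ (Module.finrank F K - 1) * (Fintype.card F - 1)) =
      Fintype.card F ^ Module.finrank F K - 1 := by
  rw [weightCount_range (affineTraceWord_injective u hε hk)]
  have hset : {p : F × K | hammingNorm (affineTraceWord ε (fun i => (u i : K)) p) =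
      Fintype.card F ^ (Module.finrank F K - 1) * (Fintype.card F - 1)} =
      ({0} : Set F) ×ˢ ({0}ᶜ : Set K) :=
    Set.ext fun p => hammingNorm_affineTraceWord_eq_iff u hε hk p
  rw [hset, Set.ncard_prod, Set.ncard_singleton, one_mul, ncard_compl_zero,
    Nat.card_eq_fintype_card, Module.card_eq_pow_finrank (K := F) (V := K)]

theorem weightCount_range_length (hε : ∀ i, ε i ≠ 0) (u : Fin n ≃ Kˣ)
    (hk : 1 < Module.finrank F K) :
    weightCount (affineTraceWord ε (fun i => (u i : K))).range
        (Fintype.card F ^ Module.finrank F K - 1) = Fintype.card F - 1 := by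
  rw [weightCount_range (affineTraceWord_injective u hε hk)]
  have hset : {p : F × K | hammingNorm (affineTraceWord ε (fun i => (u i : K)) p) =
      Fintype.card F ^ Module.finrank F K - 1} = ({0}ᶜ : Set F) ×ˢ ({0} : Set K) :=
    Set.ext fun p => hammingNorm_affineTraceWord_eq_length_iff u hε hk p
  rw [hset, Set.ncard_prod, Set.ncard_singleton, mul_one, ncard_compl_zero,
    Nat.card_eq_fintype_card]

end Codes

theorem weightCount_zero {F : Type*} [Field F] [DecidableEq F] {n : ℕ}
    (D : Submodule F (Fin n → F)) : weightCount D 0 = 1 := by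
  rw [weightCount, Set.ncard_eq_one]
  refine ⟨0, Set.ext fun c => ?_⟩
  simp only [hammingNorm_eq_zero, Set.mem_ofPred_eq, Set.mem_singleton_iff]
  exact ⟨fun h => h.2, by rintro rfl; exact ⟨D.zero_mem, rfl⟩⟩

/-! ### Irreducibility of the two component codes -/

section Irreducible

variable {F K : Type*} [Field F] [Field K] [Algebra F K] {n : ℕ} {δ : F} {β : K} {ε : Fin n → F}
  {u : Fin n → K}

theorem isCyclicCode_range (hδ : δ ^ n = 1) (hβ : β ^ n = 1)
    (h : ∀ a b i, affineTraceWord ε u (a, b) i =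
      a * δ ^ (i : ℕ) + Algebra.trace F K (b * β ^ (i : ℕ))) :
    IsCyclicCode (affineTraceWord ε u).range := by
  rintro _ ⟨⟨a, b⟩, rfl⟩
  rw [affineTraceWord_comp_finRotate hδ hβ h]
  exact ⟨_, rfl⟩

theorem isIrreducibleCyclicCode_range_inl (hδ : δ ^ n = 1) (hβ : β ^ n = 1)
    (h : ∀ a b i, affineTraceWord ε u (a, b) i =
      a * δ ^ (i : ℕ) + Algebra.trace F K (b * β ^ (i : ℕ)))
    (hinj : Function.Injective (affineTraceWord ε u)) :
    IsIrreducibleCyclicCode (affineTraceWord ε u ∘ₗ LinearMap.inl F F K).range := by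
  refine isIrreducibleCyclicCode_of_finrank_eq_one ?_ ?_
  · rintro _ ⟨a, rfl⟩
    refine ⟨a * δ, ?_⟩
    have := affineTraceWord_comp_finRotate hδ hβ h a 0
    rw [zero_mul] at this
    exact this.symm
  · rw [LinearMap.finrank_range_of_inj (f := affineTraceWord ε u ∘ₗ LinearMap.inl F F K)
      (hinj.comp LinearMap.inl_injective), Module.finrank_self]

/-- The shift acts on b as multiplication by β, so a cyclic subcode pulls back to a β-stable
subspace of K, which is 0 or K. -/
theorem isIrreducibleCyclicCode_range_inr [FiniteDimensional F K] (hδ : δ ^ n = 1)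
    (hβ : β ^ n = 1)
    (h : ∀ a b i, affineTraceWord ε u (a, b) i =
      a * δ ^ (i : ℕ) + Algebra.trace F K (b * β ^ (i : ℕ)))
    (hinj : Function.Injective (affineTraceWord ε u))
    (hdeg : (minpoly F β⁻¹).natDegree = Module.finrank F K) :
    IsIrreducibleCyclicCode (affineTraceWord ε u ∘ₗ LinearMap.inr F F K).range := by
  set Φ := affineTraceWord ε u ∘ₗ LinearMap.inr F F K with hΦ
  have hΦinj : Function.Injective Φ := hinj.comp LinearMap.inr_injective
  have hrot : ∀ b, Φ b ∘ finRotate n = Φ (b * β) := by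
    intro b
    have := affineTraceWord_comp_finRotate hδ hβ h 0 b
    rwa [zero_mul] at this
  refine ⟨?_, ?_, fun E hE hle => ?_⟩
  · rintro _ ⟨b, rfl⟩
    rw [hrot]
    exact ⟨_, rfl⟩
  · intro hbot
    have h1 : Φ 1 = 0 := by
      rw [← Submodule.mem_bot F, ← hbot]
      exact ⟨1, rfl⟩
    exact one_ne_zero (hΦinj (h1.trans (map_zero Φ).symm))
  · by_cases hE0 : E = ⊥
    · exact Or.inl hE0
    · obtain ⟨c, hc, hc0⟩ := E.ne_bot_iff.1 hE0
      obtain ⟨b, rfl⟩ := hle hc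
      have hb0 : b ≠ 0 := by rintro rfl; exact hc0 (map_zero _)
      have htop : E.comap Φ = ⊤ :=
        eq_top_of_mul_mem hdeg (fun x hx => by
          rw [Submodule.mem_comap, ← hrot]; exact hE _ hx) hc hb0
      refine Or.inr (le_antisymm hle ?_)
      rintro _ ⟨x, rfl⟩
      have : x ∈ E.comap Φ := by rw [htop]; trivial
      exact this

end Irreducible

section Primitive

variable {F K : Type*} [Field F] [Field K] [Algebra F K] [Finite K]

theorem algebraMap_norm_zpow (γ : Kˣ) (e : ℤ) :
    algebraMap F K (Algebra.norm F ((γ ^ e : Kˣ) : K)) =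
      ((γ ^ (Delta (Nat.card F) (Module.finrank F K) * e) : Kˣ) : K) := by
  rw [FiniteField.algebraMap_norm_eq_pow, Module.natCard_eq_pow_finrank (K := F) (V := K),
    ← Units.val_pow_eq_pow_val, ← zpow_natCast, ← zpow_mul, mul_comm e]
  rfl

end Primitive

end CyclicCodes

/-! ### The main theorem -/

open CyclicCodes in
theorem theorem1 {F K : Type*} [Field F] [Finite F] [DecidableEq F] [Field K] [Algebra F K]
    (q k : ℕ) (hq : Nat.card F = q) (hk : Module.finrank F K = k) (hk1 : 1 < k)
    (γ : Kˣ) (hγ : ∀ x : Kˣ, x ∈ Subgroup.zpowers γ)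
    (e₁ e₂ : ℤ)
    (h₁ : Int.gcd ((q : ℤ) - 1) ((k : ℤ) * e₁ - e₂) = 1)
    (h₂ : Int.gcd (Delta q k : ℤ) e₂ = 1)
    (f₁ f₂ : Polynomial F)
    (hf₁ : f₁ = hPoly F γ (Delta q k * e₁)) (hf₂ : f₂ = hPoly F γ e₂)
    (C₁ C₂ D : Submodule F (Fin (q ^ k - 1) → F))
    (hC₁ : C₁ = cyclicCode (q ^ k - 1) f₁) (hC₂ : C₂ = cyclicCode (q ^ k - 1) f₂)
    (hD : D = cyclicCode (q ^ k - 1) (f₁ * f₂)) :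
    -- the two irreducible codes
    (f₁.natDegree = 1 ∧ f₂.natDegree = k ∧
      IsParityCheckPolynomial f₁ C₁ ∧ IsParityCheckPolynomial f₂ C₂ ∧ C₁ ≠ C₂ ∧
      IsIrreducibleCyclicCode C₁ ∧ nonzeroWeights C₁ = {q ^ k - 1} ∧
      IsIrreducibleCyclicCode C₂ ∧ nonzeroWeights C₂ = {q ^ (k - 1) * (q - 1)}) ∧
    -- the code with parity-check polynomial `f₁ * f₂`
    (IsCyclicCode D ∧ IsParityCheckPolynomial (f₁ * f₂) D ∧
      HasParameters D (k + 1) (q ^ (k - 1) * (q - 1) - 1) ∧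
      IsGriesmerOptimal D ∧
      (nonzeroWeights D).ncard = 3 ∧
      weightCount D 0 = 1 ∧
      weightCount D (q ^ (k - 1) * (q - 1) - 1) = (q - 1) * (q ^ k - 1) ∧
      weightCount D (q ^ (k - 1) * (q - 1)) = q ^ k - 1 ∧
      weightCount D (q ^ k - 1) = q - 1 ∧
      (∀ w : ℕ, w ≠ 0 → w ≠ q ^ (k - 1) * (q - 1) - 1 → w ≠ q ^ (k - 1) * (q - 1) →
        w ≠ q ^ k - 1 → weightCount D w = 0)) ∧
    -- its dual
    (weightCount (dualCode D) 1 = 0 ∧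
      weightCount (dualCode D) 2 = 0 ∧
      (weightCount (dualCode D) 3 : ℚ) =
        ((q : ℚ) ^ k - 3) * ((q : ℚ) ^ k - 1) * ((q : ℚ) - 2) * ((q : ℚ) - 1) / 6 ∧
      (2 < q →
        HasParameters (dualCode D) (q ^ k - 2 - k) 3 ∧
        CorrectsErrors (dualCode D) 1 ∧ ¬ CorrectsErrors (dualCode D) 2)) := by
  obtain ⟨n, hn⟩ : ∃ n, n = q ^ k - 1 := ⟨_, rfl⟩
  revert C₁ C₂ D
  rw [← hn]
  intro C₁ C₂ D hC₁ hC₂ hD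
  have hfd : FiniteDimensional F K := Module.finite_of_finrank_pos (by omega)
  have hKfin : Finite K := Module.finite_of_finite F
  cases nonempty_fintype F
  cases nonempty_fintype K
  have hqF : Fintype.card F = q := by rw [← Nat.card_eq_fintype_card, hq]
  have hq2 : 2 ≤ q := hqF ▸ Fintype.one_lt_card
  have hkK : 1 < Module.finrank F K := hk ▸ hk1
  have hW := two_le_pow_mul_pred hq2 hk1
  have hWN : q ^ (k - 1) * (q - 1) < n := hn ▸ pow_mul_pred_lt hq2 hk1
  have hn0 : n ≠ 0 := by omega
  have hncard : Nat.card Kˣ = n := by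
    rw [Nat.card_units, Module.natCard_eq_pow_finrank (K := F), hq, hk, hn]
  have hnZ : (n : ℤ) = (q : ℤ) ^ k - 1 := by
    rw [hn, Nat.cast_sub (by omega)]; push_cast; rfl
  -- the points and the multipliers
  have hbij := bijective_zpow_pow hγ hncard (hnZ ▸ isCoprime_pow_sub_one hq2 h₁ h₂)
  set u : Fin n ≃ Kˣ := Equiv.ofBijective _ hbij with hu
  have hun : ∀ x : Kˣ, x ^ n = 1 := fun x => by rw [← hncard]; exact pow_card_eq_one'
  set δ : F := Algebra.norm F ((γ ^ e₁ : Kˣ) : K) with hδ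
  have hδγ : algebraMap F K δ = ((γ ^ (Delta q k * e₁) : Kˣ) : K) := by
    rw [hδ, algebraMap_norm_zpow, hq, hk]
  have hδ0 : δ ≠ 0 := by
    rintro h0
    rw [h0, map_zero] at hδγ
    exact Units.ne_zero _ hδγ.symm
  have hδn : δ ^ n = 1 := by
    apply (algebraMap F K).injective
    rw [map_pow, hδγ, map_one, ← Units.val_pow_eq_pow_val, hun, Units.val_one]
  set β : K := ((γ ^ e₂ : Kˣ) : K) with hβ
  have hβ0 : β ≠ 0 := Units.ne_zero _
  have hβn : β ^ n = 1 := by rw [hβ, ← Units.val_pow_eq_pow_val, hun, Units.val_one]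
  set ε : Fin n → F := fun i => δ ^ (i : ℕ) with hεdef
  have hε : ∀ i, ε i ≠ 0 := fun i => pow_ne_zero _ hδ0
  set Φ := affineTraceWord ε (fun i => (u i : K)) with hΦ
  have hword : ∀ a b i, Φ (a, b) i = a * δ ^ (i : ℕ) + Algebra.trace F K (b * β ^ (i : ℕ)) := by
    intro a b i
    have hβu : β ^ (i : ℕ) = δ ^ (i : ℕ) • (u i : K) := by
      rw [Algebra.smul_def, map_pow, hδγ, hβ, hu, Equiv.ofBijective_apply,
        Units.val_pow_eq_pow_val, ← mul_pow, ← Units.val_mul, ← zpow_add, add_sub_cancel]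
    rw [hΦ, affineTraceWord_apply, hβu, mul_smul_comm, map_smul, smul_eq_mul, hεdef]
    ring
  have hinj : Function.Injective Φ := affineTraceWord_injective u hε hkK
  -- the polynomials
  have hf₁eq : f₁ = X - C δ⁻¹ := by
    rw [hf₁, hPoly, ← minpoly.eq_X_sub_C K, map_inv₀, hδγ, zpow_neg, Units.val_inv_eq_inv_val]
  have hf₂eq : f₂ = minpoly F β⁻¹ := by
    rw [hf₂, hPoly, zpow_neg, Units.val_inv_eq_inv_val]
  have hf₁deg : f₁.natDegree = 1 := by rw [hf₁eq, natDegree_X_sub_C]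
  have hf₁m : f₁.Monic := hf₁eq ▸ monic_X_sub_C _
  have hf₂m : f₂.Monic := hf₂eq ▸ minpoly.monic (Algebra.IsIntegral.isIntegral _)
  have hf₁dvd : f₁ ∣ X ^ n - 1 := by
    rw [hf₁eq, dvd_iff_isRoot]
    simp [hδn]
  have hf₂dvd : f₂ ∣ X ^ n - 1 := by
    rw [hf₂eq]
    exact minpoly.dvd _ _ (by simp [hβn])
  -- the words
  have hle₁ : (Φ ∘ₗ LinearMap.inl F F K).range ≤ C₁ := by
    rintro _ ⟨a, rfl⟩
    -- Here the extension field is F itself, and the functional is multiplication by a.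
    have := functional_pow_mem_cyclicCode (n := n) (h := f₁) (LinearMap.mulLeft F a) hδn hδ0
      (by simp [hf₁eq])
    rw [hC₁]
    convert this using 1
    ext i
    simp [hword]
  have hle₂ : (Φ ∘ₗ LinearMap.inr F F K).range ≤ C₂ := by
    rintro _ ⟨b, rfl⟩
    have := functional_pow_mem_cyclicCode (n := n) (h := f₂)
      (Algebra.trace F K ∘ₗ LinearMap.mulLeft F b) hβn hβ0 (by rw [hf₂eq, minpoly.aeval])
    rw [hC₂]
    convert this using 1
    ext i
    simp [hword]
  have hr₁ : Module.finrank F (Φ ∘ₗ LinearMap.inl F F K).range = 1 := by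
    rw [LinearMap.finrank_range_of_inj (f := Φ ∘ₗ LinearMap.inl F F K)
      (hinj.comp LinearMap.inl_injective), Module.finrank_self]
  have hr₂ : Module.finrank F (Φ ∘ₗ LinearMap.inr F F K).range = k := by
    rw [LinearMap.finrank_range_of_inj (f := Φ ∘ₗ LinearMap.inr F F K)
      (hinj.comp LinearMap.inr_injective), hk]
  have hr : Module.finrank F Φ.range = k + 1 := by
    rw [LinearMap.finrank_range_of_inj hinj, Module.finrank_prod, Module.finrank_self, hk,
      add_comm]
  -- The k-dimensional space of trace words inside `C₂` forces the degree up to k.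
  have hf₂deg : f₂.natDegree = k := by
    refine le_antisymm ?_ ?_
    · rw [hf₂eq, ← hk]
      exact minpoly.natDegree_le _
    · calc k = _ := hr₂.symm
        _ ≤ Module.finrank F C₂ := Submodule.finrank_mono hle₂
        _ ≤ f₂.natDegree := hC₂ ▸ finrank_cyclicCode_le hn0 hf₂dvd
  have hcop : IsCoprime f₁ f₂ := by
    have hirr₁ : Irreducible f₁ := hf₁eq ▸ irreducible_X_sub_C _
    have hirr₂ : Irreducible f₂ := hf₂eq ▸ minpoly.irreducible (Algebra.IsIntegral.isIntegral _)
    rw [hirr₁.coprime_iff_not_dvd]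
    intro hdvd
    have heq := eq_of_monic_of_associated hf₁m hf₂m (hirr₁.associated_of_dvd hirr₂ hdvd)
    rw [heq, hf₂deg] at hf₁deg
    omega
  have hfdvd : f₁ * f₂ ∣ X ^ n - 1 := hcop.mul_dvd hf₁dvd hf₂dvd
  have hC₁eq : C₁ = (Φ ∘ₗ LinearMap.inl F F K).range :=
    (Submodule.eq_of_le_of_finrank_le hle₁ (by
      rw [hr₁, hC₁, ← hf₁deg]; exact finrank_cyclicCode_le hn0 hf₁dvd)).symm
  have hC₂eq : C₂ = (Φ ∘ₗ LinearMap.inr F F K).range :=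
    (Submodule.eq_of_le_of_finrank_le hle₂ (by
      rw [hr₂, hC₂]; exact (finrank_cyclicCode_le hn0 hf₂dvd).trans_eq hf₂deg)).symm
  have hle : Φ.range ≤ D := by
    rintro _ ⟨⟨a, b⟩, rfl⟩
    have hab : Φ (a, b) = (Φ ∘ₗ LinearMap.inl F F K) a + (Φ ∘ₗ LinearMap.inr F F K) b := by
      simp [← map_add]
    have h1 : (Φ ∘ₗ LinearMap.inl F F K) a ∈ cyclicCode n f₁ := hC₁ ▸ hle₁ ⟨a, rfl⟩
    have h2 : (Φ ∘ₗ LinearMap.inr F F K) b ∈ cyclicCode n f₂ := hC₂ ▸ hle₂ ⟨b, rfl⟩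
    rw [hab, hD]
    exact Submodule.add_mem _ (cyclicCode_le_of_dvd (dvd_mul_right _ _) h1)
      (cyclicCode_le_of_dvd (dvd_mul_left _ _) h2)
  have hDeq : D = Φ.range :=
    (Submodule.eq_of_le_of_finrank_le hle (by
      rw [hr, hD]
      refine (finrank_cyclicCode_le hn0 hfdvd).trans_eq ?_
      rw [hf₁m.natDegree_mul hf₂m, hf₁deg, hf₂deg, add_comm])).symm
  have hw₁ : nonzeroWeights C₁ = {n} := by
    rw [hC₁eq, nonzeroWeights_range_inl hε u, hqF, hk, hn]
  have hw₂ : nonzeroWeights C₂ = {q ^ (k - 1) * (q - 1)} := by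
    rw [hC₂eq, nonzeroWeights_range_inr hε u hkK, hqF, hk]
  have hwD : nonzeroWeights D =
      {q ^ (k - 1) * (q - 1) - 1, q ^ (k - 1) * (q - 1), n} := by
    rw [hDeq, nonzeroWeights_range hε u hkK, hqF, hk, hn]
  have hparam : HasParameters D (k + 1) (q ^ (k - 1) * (q - 1) - 1) := by
    refine ⟨hDeq ▸ hr, ?_⟩
    rw [setOf_hammingDist_eq_nonzeroWeights, hwD]
    refine ⟨by simp, ?_⟩
    rintro w (rfl | rfl | rfl) <;> omega
  have hdual : ∀ y ∈ dualCode D, hammingNorm y ≤ 2 → y = 0 := fun y hy hy2 =>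
    eq_zero_of_mem_dualCode_range hε (Units.val_injective.comp u.injective)
      (by rw [hDeq] at hy; exact hy) hy2
  have hB3 : 6 * weightCount (dualCode D) 3 = (q - 1) * ((q - 2) * (n * (n - 2))) := by
    rw [hDeq, six_mul_weightCount_dualCode_range hε u, hq]
  refine ⟨⟨hf₁deg, hf₂deg, ?_, ?_, ?_, ?_, hw₁, ?_, hw₂⟩,
    ⟨?_, ?_, hparam, ?_, ?_, weightCount_zero D, ?_, ?_, ?_, ?_⟩, ?_, ?_, ?_, ?_⟩
  · exact hC₁ ▸ isParityCheckPolynomial_cyclicCode hn0 hf₁m hf₁dvd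
  · exact hC₂ ▸ isParityCheckPolynomial_cyclicCode hn0 hf₂m hf₂dvd
  · intro h
    rw [h, hw₂, Set.singleton_eq_singleton_iff] at hw₁
    omega
  · exact hC₁eq ▸ isIrreducibleCyclicCode_range_inl hδn hβn hword hinj
  · exact hC₂eq ▸ isIrreducibleCyclicCode_range_inr hδn hβn hword hinj
      (by rw [← hf₂eq, hf₂deg, hk])
  · exact hDeq ▸ isCyclicCode_range hδn hβn hword
  · exact hD ▸ isParityCheckPolynomial_cyclicCode hn0 (hf₁m.mul hf₂m) hfdvd
  · exact ⟨_, _, hparam, by rw [hq]; exact hn.trans (griesmer_sum hq2 hk1)⟩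
  · rw [hwD, Set.ncard_eq_three]
    exact ⟨_, _, _, by omega, by omega, by omega, rfl⟩
  · have := weightCount_range_pred hε u hkK
    rwa [hqF, hk, ← hn, ← hΦ, ← hDeq] at this
  · have := weightCount_range_middle hε u hkK
    rwa [hqF, hk, ← hn, ← hΦ, ← hDeq] at this
  · have := weightCount_range_length hε u hkK
    rwa [hqF, hk, ← hn, ← hΦ, ← hDeq] at this
  · intro w hw0 hw1 hw2 hw3
    rw [weightCount_eq_zero_iff]
    rintro c hc rfl
    have hmem : hammingNorm c ∈ nonzeroWeights D := ⟨c, hc, hammingNorm_ne_zero_iff.1 hw0, rfl⟩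
    rw [hwD] at hmem
    rcases hmem with h | h | h
    exacts [hw1 h, hw2 h, hw3 h]
  · rw [weightCount_eq_zero_iff]
    intro c hc h
    rw [hdual c hc (by omega), hammingNorm_zero] at h
    omega
  · rw [weightCount_eq_zero_iff]
    intro c hc h
    rw [hdual c hc (by omega), hammingNorm_zero] at h
    omega
  · have hcast : (6 : ℚ) * (weightCount (dualCode D) 3 : ℚ) =
        ((q - 1 : ℕ) : ℚ) * (((q - 2 : ℕ) : ℚ) * ((n : ℚ) * ((n - 2 : ℕ) : ℚ))) := by
      exact_mod_cast hB3
    have hnQ : (n : ℚ) = (q : ℚ) ^ k - 1 := by exact_mod_cast hnZ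
    rw [Nat.cast_sub (by omega : 1 ≤ q), Nat.cast_sub hq2, Nat.cast_sub (by omega : 2 ≤ n),
      hnQ] at hcast
    push_cast at hcast
    linear_combination hcast / 6
  · intro hq3
    have hpos : weightCount (dualCode D) 3 ≠ 0 := by
      intro h0
      rw [h0, mul_zero] at hB3
      -- q > 2 makes the factor q - 2 positive; n > q^(k-1)(q-1) ≥ 2 handles n - 2.
      have : 0 < (q - 1) * ((q - 2) * (n * (n - 2))) :=
        Nat.mul_pos (by omega) (Nat.mul_pos (by omega) (Nat.mul_pos (by omega) (by omega)))
      omega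
    rw [ne_eq, weightCount_eq_zero_iff] at hpos
    push Not at hpos
    obtain ⟨c, hc, hc3⟩ := hpos
    refine ⟨⟨?_, ?_⟩, correctsErrors_one hdual, not_correctsErrors_two hc hc3⟩
    · rw [finrank_dualCode, hDeq, hr]
      omega
    · rw [setOf_hammingDist_eq_nonzeroWeights]
      refine ⟨⟨c, hc, by rintro rfl; simp at hc3, hc3⟩, ?_⟩
      rintro w ⟨y, hy, hy0, rfl⟩
      by_contra hlt
      exact hy0 (hdual y hy (by omega))
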